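/- Let $n\in\mathbb N$, let $\alpha\in[0,\pi/2)$, and let $A,B$ be complex $n\times n$ matrices that are sectorial with angle $\alpha$, i.e. for every unit vector $x\in\mathbb C^n$ the number $z=\langle Ax,x\rangle$ satisfies $\operatorname{Re}z>0$ and $|\operatorname{Im}z|\le\tan(\alpha)\operatorname{Re}z$, and likewise for $B$. Let $q\in\mathbb C$ with $0<|q|\le1$, let $0<t<1$, and for a matrix $T$ let $$w_q(T)=\sup\{|\langle Tx,y\rangle| : x,y\in\mathbb C^n,\ \|x\|=\|y\|=1,\ \langle x,y\rangle=q\}$$ be its $q$-numerical radius. (If $n=1$ and $|q|<1$ this set is empty; there, and for $n=0$, the convention is $\sup\emptyset=0$ and $0^{-1}=0$.) Let $$A\#_tB=\frac{\sin(\pi t)}{\pi}\int_0^\infty s^{t-1}\,(A^{-1}+sB^{-1})^{-1}\,ds,\qquad A\,!_t\,B=\big((1-t)A^{-1}+tB^{-1}\big)^{-1}$$ be the weighted geometric mean and the weighted harmonic mean of $A$ and $B$. Then (a) $|q|^2\,w_q(A\#_tB)\le\sec^3(\alpha)\,w_q(A)^{1-t}\,w_q(B)^{t}$; (b) $|q|^2\,w_q(A\,!_t\,B)\le\sec^3(\alpha)\,\big((1-t)\,w_q(A)^{-1}+t\,w_q(B)^{-1}\big)^{-1}$.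 -/

import Mathlib

namespace SectorialMeans

noncomputable section

/-- The classical numerical range `W(T) = {⟨T x, x⟩ : ‖x‖ = 1}` of a complex matrix acting on
`ℂⁿ` with its Euclidean inner product. (Mathlib's `inner ℂ u v` is linear in `v`, so the
inner product `⟨u, v⟩` that is linear in its first argument is `inner ℂ v u`.) -/
def numericalRange {n : ℕ} (T : Matrix (Fin n) (Fin n) ℂ) : Set ℂ :=
  {z | ∃ x : EuclideanSpace ℂ (Fin n), ‖x‖ = 1 ∧ z = inner ℂ x (T.toEuclideanLin x)}

/-- The `q`-numerical range `W_q(T) = {⟨T x, y⟩ : ‖x‖ = ‖y‖ = 1, ⟨x, y⟩ = q}`, where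
`⟨u, v⟩` is linear in `u`, i.e. `⟨u, v⟩ = inner ℂ v u`. -/
def qNumericalRange {n : ℕ} (q : ℂ) (T : Matrix (Fin n) (Fin n) ℂ) : Set ℂ :=
  {z | ∃ x y : EuclideanSpace ℂ (Fin n), ‖x‖ = 1 ∧ ‖y‖ = 1 ∧ inner ℂ y x = q ∧
    z = inner ℂ y (T.toEuclideanLin x)}

/-- The `q`-numerical radius `w_q(T) = sup {|z| : z ∈ W_q(T)}`. -/
def qNumericalRadius {n : ℕ} (q : ℂ) (T : Matrix (Fin n) (Fin n) ℂ) : ℝ :=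
  sSup ((fun z : ℂ => ‖z‖) '' qNumericalRange q T)

/-- The sector `S_α = {z : Re z > 0, |Im z| ≤ tan α · Re z}`. -/
def sector (α : ℝ) : Set ℂ :=
  {z | 0 < z.re ∧ |z.im| ≤ Real.tan α * z.re}

/-- `T` is sectorial with angle `α`: `W(T) ⊆ S_α`. -/
def IsSectorial {n : ℕ} (α : ℝ) (T : Matrix (Fin n) (Fin n) ℂ) : Prop :=
  numericalRange T ⊆ sector α

/-- The weighted geometric mean of accretive matrices,
`A #_t B = (sin (π t) / π) ∫₀^∞ s^(t-1) (A⁻¹ + s B⁻¹)⁻¹ ds`, the integral being taken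
entrywise. -/
def weightedGeometricMean {n : ℕ} (t : ℝ) (A B : Matrix (Fin n) (Fin n) ℂ) :
    Matrix (Fin n) (Fin n) ℂ :=
  Matrix.of fun i j =>
    ((Real.sin (Real.pi * t) / Real.pi : ℝ) : ℂ) *
      ∫ s in Set.Ioi (0 : ℝ), ((s ^ (t - 1) : ℝ) : ℂ) * (A⁻¹ + (s : ℂ) • B⁻¹)⁻¹ i j

/-- The weighted harmonic mean `A !_t B = ((1 - t) A⁻¹ + t B⁻¹)⁻¹`. -/
def weightedHarmonicMean {n : ℕ} (t : ℝ) (A B : Matrix (Fin n) (Fin n) ℂ) :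
    Matrix (Fin n) (Fin n) ℂ :=
  (((1 - t : ℝ) : ℂ) • A⁻¹ + (t : ℂ) • B⁻¹)⁻¹

end

end SectorialMeans

/-! ### Scalar beta-type integrals -/

namespace SectorialMeans

open MeasureTheory Set

/-! Both means are built from inverses of `r A⁻¹ + s B⁻¹`, and everything reduces to a scalar bound
on those. Averaging over `y = conj q • x ± z` with `z ⟂ x` gives `|q| |⟨Ax, x⟩| ≤ w_q(A)`, so `Re A
≤ a` with `a = w_q(A) / |q|`; likewise `Re B ≤ b`. Cauchy–Schwarz for sectorial forms
(`norm_inner_sq_le_of_slope`) yields `‖Av‖² ≤ sec² α · a · Re ⟨Av, v⟩`; putting `x = Av`, this says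
`Re A⁻¹ ≥ cos² α / a`. Such lower bounds add, and a lower bound `c` on the real part bounds the
inverse by `c⁻¹`, so `‖(r A⁻¹ + s B⁻¹)⁻¹‖ ≤ sec² α (r/a + s/b)⁻¹`. Taking `r = 1 - t`, `s = t` gives
the harmonic mean; integrating against `s^(t-1)` with `r = 1` gives the geometric one, the scalar
integral being a beta integral. Finally `w_q ≤ ‖·‖`, and both scalar means are homogeneous of degree
one, so one factor `1/|q|` comes out. -/

lemma integral_Ioo_rpow_mul_one_sub_rpow {t : ℝ} (ht0 : 0 < t) (ht1 : t < 1) :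
    ∫ x in Ioo (0 : ℝ) 1, x ^ (t - 1) * (1 - x) ^ (-t) = Real.pi / Real.sin (Real.pi * t) := by
  have h := Complex.Gamma_mul_Gamma_eq_betaIntegral (s := (t : ℂ)) (t := ((1 - t : ℝ) : ℂ))
    (by simpa using ht0) (by simpa using ht1)
  have h1 : (t : ℂ) + ((1 - t : ℝ) : ℂ) = 1 := by push_cast; ring
  rw [h1, Complex.Gamma_one, one_mul, Complex.Gamma_ofReal, Complex.Gamma_ofReal,
    ← Complex.ofReal_mul, Real.Gamma_mul_Gamma_one_sub, Complex.betaIntegral,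
    intervalIntegral.integral_of_le zero_le_one, integral_Ioc_eq_integral_Ioo] at h
  have h2 : ∫ x in Ioo (0 : ℝ) 1, (x : ℂ) ^ ((t : ℂ) - 1) *
      (1 - (x : ℂ)) ^ (((1 - t : ℝ) : ℂ) - 1) =
      ∫ x in Ioo (0 : ℝ) 1, ((x ^ (t - 1) * (1 - x) ^ (-t) : ℝ) : ℂ) := by
    refine setIntegral_congr_fun measurableSet_Ioo fun x hx => ?_
    have hx1 : 0 ≤ 1 - x := by linarith [hx.2]
    simp only [Complex.ofReal_mul, Complex.ofReal_cpow hx.1.le, Complex.ofReal_cpow hx1]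
    push_cast
    congr 2
    ring
  rw [h2, integral_complex_ofReal] at h
  exact (Complex.ofReal_injective h).symm

lemma image_div_add_Ioi {r p : ℝ} (hr : 0 < r) (hp : 0 < p) :
    (fun s : ℝ => p * s / (r + p * s)) '' Ioi 0 = Ioo 0 1 := by
  ext x
  constructor
  · rintro ⟨s, hs, rfl⟩
    have hs : 0 < s := hs
    have : 0 < p * s := by positivity
    refine ⟨by positivity, ?_⟩
    rw [div_lt_one (by positivity)]
    linarith
  · rintro ⟨h0, h1⟩
    have h2 : 0 < 1 - x := by linarith
    refine ⟨r * x / (p * (1 - x)), by simp only [mem_Ioi]; positivity, ?_⟩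
    simp only
    field_simp
    ring

/-- The integral behind the integral representation of the weighted geometric mean of the
positive numbers `r⁻¹` and `p⁻¹`. -/
lemma integral_Ioi_rpow_div_add {t r p : ℝ} (ht0 : 0 < t) (ht1 : t < 1) (hr : 0 < r)
    (hp : 0 < p) :
    ∫ s in Ioi (0 : ℝ), s ^ (t - 1) * (r + s * p)⁻¹ =
      (Real.pi / Real.sin (Real.pi * t)) * ((r⁻¹) ^ (1 - t) * (p⁻¹) ^ t) := by
  -- The substitution `x = ps / (r + ps)` carries `(0, ∞)` onto `(0, 1)` and turns the integral into
  -- `B(t, 1 - t)`.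
  have hd : ∀ s ∈ Ioi (0 : ℝ), HasDerivWithinAt (fun s : ℝ => p * s / (r + p * s))
      (p * r / (r + p * s) ^ 2) (Ioi 0) s := by
    intro s hs
    have hs : 0 < s := hs
    have hne : r + p * s ≠ 0 := by positivity
    have h1 : HasDerivAt (fun s : ℝ => p * s) p s := by
      simpa using (hasDerivAt_id s).const_mul p
    have h2 := h1.div (h1.const_add r) hne
    refine (h2.congr_deriv ?_).hasDerivWithinAt
    congr 1
    ring
  have hinj : InjOn (fun s : ℝ => p * s / (r + p * s)) (Ioi 0) := by
    intro s hs u hu h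
    have hs : 0 < s := hs
    have hu : 0 < u := hu
    simp only at h
    rw [div_eq_div_iff (by positivity) (by positivity)] at h
    have h3 : (p * r) * s = (p * r) * u := by linear_combination h
    exact mul_left_cancel₀ (by positivity) h3
  have h := integral_image_eq_integral_abs_deriv_smul measurableSet_Ioi hd hinj
    (fun x => x ^ (t - 1) * (1 - x) ^ (-t))
  rw [image_div_add_Ioi hr hp, integral_Ioo_rpow_mul_one_sub_rpow ht0 ht1] at h
  have h4 : ∫ s in Ioi (0 : ℝ), |p * r / (r + p * s) ^ 2| •
      ((p * s / (r + p * s)) ^ (t - 1) * (1 - p * s / (r + p * s)) ^ (-t)) =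
      ∫ s in Ioi (0 : ℝ), (p ^ t * r ^ (1 - t)) * (s ^ (t - 1) * (r + s * p)⁻¹) := by
    refine setIntegral_congr_fun measurableSet_Ioi fun s hs => ?_
    have hs : 0 < s := hs
    have hpos : 0 < r + p * s := by positivity
    have e1 : 1 - p * s / (r + p * s) = r / (r + p * s) := by field_simp; ring
    rw [e1, abs_of_pos (by positivity), smul_eq_mul, Real.div_rpow (by positivity) hpos.le,
      Real.div_rpow hr.le hpos.le, Real.mul_rpow hp.le hs.le, Real.rpow_sub_one hp.ne',
      Real.rpow_sub_one hpos.ne', Real.rpow_neg hpos.le, Real.rpow_neg hr.le,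
      Real.rpow_sub hr, Real.rpow_one, mul_comm s p]
    have := Real.rpow_pos_of_pos hpos t
    have := Real.rpow_pos_of_pos hr t
    field_simp
  rw [h4, integral_const_mul] at h
  rw [h, Real.inv_rpow hr.le, Real.inv_rpow hp.le]
  have := Real.rpow_pos_of_pos hp t
  have := Real.rpow_pos_of_pos hr (1 - t)
  generalize ∫ s in Ioi (0 : ℝ), s ^ (t - 1) * (r + s * p)⁻¹ = J
  field_simp

lemma integrableOn_Ioi_rpow_div_add {t r p : ℝ} (ht0 : 0 < t) (ht1 : t < 1) (hr : 0 < r)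
    (hp : 0 < p) :
    IntegrableOn (fun s : ℝ => s ^ (t - 1) * (r + s * p)⁻¹) (Ioi 0) := by
  -- A non-integrable function has integral `0` by convention, whereas this integral is positive.
  refine not_imp_comm.1 integral_undef ?_
  rw [integral_Ioi_rpow_div_add ht0 ht1 hr hp]
  have : 0 < Real.sin (Real.pi * t) := Real.sin_pos_of_pos_of_lt_pi (by positivity)
    (by nlinarith [Real.pi_pos])
  positivity

end SectorialMeans

namespace SectorialMeans

open ComplexConjugate

/-! ### Cauchy–Schwarz for sectorial forms -/

section Form

variable {E : Type*} [NormedAddCommGroup E] [InnerProductSpace ℂ E]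

/-- Cauchy–Schwarz for the Hermitian form of the real part of `c • f`. -/
lemma norm_hermitianPart_sq_le (f : E →ₗ[ℂ] E) (c : ℂ)
    (hf : ∀ x, 0 ≤ (c * inner ℂ x (f x)).re) (x y : E) :
    ‖c * inner ℂ x (f y) + conj (c * inner ℂ y (f x))‖ ^ 2 ≤
      (2 * (c * inner ℂ x (f x)).re) * (2 * (c * inner ℂ y (f y)).re) := by
  let core : PreInnerProductSpace.Core ℂ E :=
    { inner := fun x y => c * inner ℂ x (f y) + conj (c * inner ℂ y (f x))
      conj_inner_symm := fun x y => by
        simp only [map_add, Complex.conj_conj]; ring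
      re_inner_nonneg := fun x => by
        have := hf x
        simp only [RCLike.re_to_complex, Complex.add_re, Complex.conj_re]
        linarith
      add_left := fun x y z => by
        simp only [inner_add_left, map_add, inner_add_right, mul_add]; ring
      smul_left := fun x y r => by
        simp only [inner_smul_left, map_smul, inner_smul_right, map_mul]; ring }
  have h := @InnerProductSpace.Core.inner_mul_inner_self_le ℂ E _ _ _ core x y
  rw [@InnerProductSpace.Core.norm_inner_symm ℂ E _ _ _ core y x, ← sq] at h
  refine h.trans_eq ?_
  change (c * inner ℂ x (f x) + conj (c * inner ℂ x (f x))).re *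
    (c * inner ℂ y (f y) + conj (c * inner ℂ y (f y))).re = _
  simp only [Complex.add_re, Complex.conj_re]
  ring

/-- Cauchy–Schwarz for a sectorial form of slope `k`. -/
lemma norm_inner_sq_le_of_pos_slope (f : E →ₗ[ℂ] E) {k : ℝ} (hk : 0 < k)
    (hf : ∀ x, |(inner ℂ x (f x)).im| ≤ k * (inner ℂ x (f x)).re) (x y : E) :
    ‖inner ℂ x (f y)‖ ^ 2 ≤ (1 + k ^ 2) * ((inner ℂ x (f x)).re * (inner ℂ y (f y)).re) := by
  -- The sector is the intersection of the half-planes `Re ((k ± i) z) ≥ 0`, so both `(k ± i) • f`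
  -- have positive semidefinite Hermitian part.
  have re1 : ∀ z : ℂ, (((k : ℂ) + Complex.I) * z).re = k * z.re - z.im := by intro z; simp
  have re2 : ∀ z : ℂ, (((k : ℂ) - Complex.I) * z).re = k * z.re + z.im := by intro z; simp
  have p1 : ∀ x, 0 ≤ (((k : ℂ) + Complex.I) * inner ℂ x (f x)).re := fun x => by
    rw [re1]; linarith [(abs_le.1 (hf x)).2]
  have p2 : ∀ x, 0 ≤ (((k : ℂ) - Complex.I) * inner ℂ x (f x)).re := fun x => by
    rw [re2]; linarith [(abs_le.1 (hf x)).1]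
  have h1 := norm_hermitianPart_sq_le f _ p1 x y
  have h2 := norm_hermitianPart_sq_le f _ p2 x y
  have q1 := p1 x
  have q2 := p2 x
  have q3 := p1 y
  have q4 := p2 y
  simp only [re1, re2] at h1 h2 q1 q2 q3 q4
  set u := ((k : ℂ) + Complex.I) * inner ℂ x (f y) + conj (((k : ℂ) + Complex.I) * inner ℂ y (f x))
    with hu
  set v := ((k : ℂ) - Complex.I) * inner ℂ x (f y) + conj (((k : ℂ) - Complex.I) * inner ℂ y (f x))
    with hv
  -- This combination of the two Hermitian forms cancels `⟪y, f x⟫`; the coefficient is `(k + i)² -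
  -- (k - i)² = 4ki`.
  have key : (4 * k * Complex.I) * inner ℂ x (f y) =
      ((k : ℂ) + Complex.I) * u - ((k : ℂ) - Complex.I) * v := by
    rw [hu, hv]
    simp only [map_mul, map_add, map_sub, Complex.conj_I, Complex.conj_ofReal]
    ring
  have n1 : ‖(k : ℂ) + Complex.I‖ ^ 2 = 1 + k ^ 2 := by
    rw [Complex.sq_norm, Complex.normSq_apply]; simp; ring
  have n2 : ‖(k : ℂ) - Complex.I‖ = ‖(k : ℂ) + Complex.I‖ := by
    rw [← Complex.norm_conj]; simp
  have h3 : 4 * k * ‖inner ℂ x (f y)‖ ≤ ‖(k : ℂ) + Complex.I‖ * (‖u‖ + ‖v‖) := by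
    have h5 := norm_sub_le (((k : ℂ) + Complex.I) * u) (((k : ℂ) - Complex.I) * v)
    rw [norm_mul _ u, norm_mul _ v, n2, ← key] at h5
    simp only [norm_mul, Complex.norm_I, Complex.norm_real, Real.norm_eq_abs, abs_of_pos hk,
      mul_one, Complex.norm_ofNat] at h5
    linarith
  have h6 : (‖u‖ + ‖v‖) ^ 2 ≤
      16 * k ^ 2 * ((inner ℂ x (f x)).re * (inner ℂ y (f y)).re) := by
    -- Here `‖u‖² ≤ 4ac` and `‖v‖² ≤ 4bd`, so Cauchy–Schwarz in the plane gives `(‖u‖ + ‖v‖)² ≤ 4(a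
    -- + b)(c + d)`.
    set a := k * (inner ℂ x (f x)).re - (inner ℂ x (f x)).im
    set b := k * (inner ℂ x (f x)).re + (inner ℂ x (f x)).im
    set c := k * (inner ℂ y (f y)).re - (inner ℂ y (f y)).im
    set d := k * (inner ℂ y (f y)).re + (inner ℂ y (f y)).im
    have h7 : 16 * k ^ 2 * ((inner ℂ x (f x)).re * (inner ℂ y (f y)).re) =
      4 * ((a + b) * (c + d)) := by simp only [a, b, c, d]; ring
    rw [h7]
    have h8 : (‖u‖ * ‖v‖) ^ 2 ≤ (2 * (a * d + b * c)) ^ 2 := by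
      calc (‖u‖ * ‖v‖) ^ 2 = ‖u‖ ^ 2 * ‖v‖ ^ 2 := by ring
        _ ≤ (2 * a * (2 * c)) * (2 * b * (2 * d)) := by gcongr
        _ ≤ _ := by nlinarith [sq_nonneg (a * d - b * c)]
    have h9 : ‖u‖ * ‖v‖ ≤ 2 * (a * d + b * c) := by
      refine le_of_sq_le_sq h8 (by positivity)
    nlinarith
  have h10 : (4 * k * ‖inner ℂ x (f y)‖) ^ 2 ≤ (‖(k : ℂ) + Complex.I‖ * (‖u‖ + ‖v‖)) ^ 2 := by
    gcongr
  rw [mul_pow, mul_pow _ (‖u‖ + ‖v‖), n1] at h10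
  have h11 : (1 + k ^ 2) * (‖u‖ + ‖v‖) ^ 2 ≤ (1 + k ^ 2) *
    (16 * k ^ 2 * ((inner ℂ x (f x)).re * (inner ℂ y (f y)).re)) := by gcongr
  have h12 : (16 * k ^ 2) * ‖inner ℂ x (f y)‖ ^ 2 ≤ (16 * k ^ 2) *
      ((1 + k ^ 2) * ((inner ℂ x (f x)).re * (inner ℂ y (f y)).re)) := by nlinarith
  exact le_of_mul_le_mul_left h12 (by positivity)

/-- The division by `k` excludes slope `0`. A form of slope `k` also has every slope `l > k`, and
letting `l ↓ k` covers that case. -/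
lemma norm_inner_sq_le_of_slope (f : E →ₗ[ℂ] E) {k : ℝ} (hk : 0 ≤ k)
    (hf : ∀ x, 0 ≤ (inner ℂ x (f x)).re ∧ |(inner ℂ x (f x)).im| ≤ k * (inner ℂ x (f x)).re)
    (x y : E) :
    ‖inner ℂ x (f y)‖ ^ 2 ≤ (1 + k ^ 2) * ((inner ℂ x (f x)).re * (inner ℂ y (f y)).re) := by
  have hc : Filter.Tendsto (fun l : ℝ => (1 + l ^ 2) *
      ((inner ℂ x (f x)).re * (inner ℂ y (f y)).re)) (nhdsWithin k (Set.Ioi k))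
      (nhds ((1 + k ^ 2) * ((inner ℂ x (f x)).re * (inner ℂ y (f y)).re))) :=
    (Continuous.tendsto (by fun_prop) k).mono_left nhdsWithin_le_nhds
  refine ge_of_tendsto hc ?_
  filter_upwards [self_mem_nhdsWithin] with l hl
  refine norm_inner_sq_le_of_pos_slope f (hk.trans_lt hl) (fun z => (hf z).2.trans ?_) x y
  exact mul_le_mul_of_nonneg_right (le_of_lt hl) (hf z).1

/-- If moreover the numerical range of `f` is bounded by `a`, then `f` is dominated by its
real part. -/
lemma norm_sq_le_of_slope (f : E →ₗ[ℂ] E) {k a : ℝ} (hk : 0 ≤ k)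
    (hf : ∀ x, 0 ≤ (inner ℂ x (f x)).re ∧ |(inner ℂ x (f x)).im| ≤ k * (inner ℂ x (f x)).re)
    (ha : ∀ x, (inner ℂ x (f x)).re ≤ a * ‖x‖ ^ 2) (v : E) :
    ‖f v‖ ^ 2 ≤ (1 + k ^ 2) * a * (inner ℂ v (f v)).re := by
  -- Testing against `f v` makes the left side `‖f v‖⁴`; the bound `a` then allows a factor `‖f v‖²`
  -- to be cancelled.
  have h := norm_inner_sq_le_of_slope f hk hf (f v) v
  rw [inner_self_eq_norm_sq_to_K] at h
  simp only [Complex.coe_algebraMap, norm_pow, Complex.norm_real, norm_norm] at h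
  have h1 := ha (f v)
  have h2 := (hf v).1
  rcases eq_or_ne (f v) 0 with h0 | h0
  · simp [h0]
  have h3 : 0 < ‖f v‖ ^ 2 := by positivity
  refine le_of_mul_le_mul_left (a := ‖f v‖ ^ 2) ?_ h3
  calc ‖f v‖ ^ 2 * ‖f v‖ ^ 2 = (‖f v‖ ^ 2) ^ 2 := by ring
    _ ≤ _ := h
    _ ≤ (1 + k ^ 2) * ((a * ‖f v‖ ^ 2) * (inner ℂ v (f v)).re) := by gcongr
    _ = _ := by ring

end Form

end SectorialMeans

namespace SectorialMeans

open ComplexConjugate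

variable {n : ℕ}

/-! ### The `q`-numerical radius -/

section Radius

lemma norm_inner_le_qNumericalRadius (q : ℂ) (T : Matrix (Fin n) (Fin n) ℂ)
    {x y : EuclideanSpace ℂ (Fin n)} (hx : ‖x‖ = 1) (hy : ‖y‖ = 1) (hxy : inner ℂ y x = q) :
    ‖inner ℂ y (T.toEuclideanLin x)‖ ≤ qNumericalRadius q T := by
  refine le_csSup ⟨‖T.toEuclideanLin.toContinuousLinearMap‖, ?_⟩
    ⟨_, ⟨x, y, hx, hy, hxy, rfl⟩, rfl⟩
  rintro _ ⟨_, ⟨u, v, hu, hv, -, rfl⟩, rfl⟩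
  have h := T.toEuclideanLin.toContinuousLinearMap.le_opNorm u
  rw [hu, mul_one] at h
  refine (norm_inner_le_norm _ _).trans ?_
  rw [hv, one_mul]
  exact h

lemma qNumericalRadius_le {q : ℂ} {T : Matrix (Fin n) (Fin n) ℂ} {C : ℝ} (hC : 0 ≤ C)
    (h : ∀ x, ‖T.toEuclideanLin x‖ ≤ C * ‖x‖) : qNumericalRadius q T ≤ C := by
  refine Real.sSup_le ?_ hC
  rintro _ ⟨_, ⟨u, v, hu, hv, -, rfl⟩, rfl⟩
  refine (norm_inner_le_norm _ _).trans ?_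
  simpa [hu, hv] using h u

lemma qNumericalRadius_nonneg (q : ℂ) (T : Matrix (Fin n) (Fin n) ℂ) :
    0 ≤ qNumericalRadius q T := by
  refine Real.sSup_nonneg ?_
  rintro _ ⟨_, -, rfl⟩
  exact norm_nonneg _

lemma qNumericalRadius_eq_zero_of_forall {q : ℂ}
    (h : ∀ x y : EuclideanSpace ℂ (Fin n), ‖x‖ = 1 → ‖y‖ = 1 → inner ℂ y x ≠ q)
    (T : Matrix (Fin n) (Fin n) ℂ) : qNumericalRadius q T = 0 := by
  have : qNumericalRange q T = ∅ := by
    refine Set.eq_empty_of_forall_notMem ?_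
    rintro _ ⟨x, y, hx, hy, hxy, -⟩
    exact h x y hx hy hxy
  simp [qNumericalRadius, this]

variable {E : Type*} [NormedAddCommGroup E] [InnerProductSpace ℂ E]

/-- If some unit vectors have inner product `q`, every unit vector has an orthogonal vector of
square norm `1 - ‖q‖ ^ 2`. -/
lemma exists_inner_eq_zero_norm_sq_eq {q : ℂ} {x₀ y₀ : E} (hx₀ : ‖x₀‖ = 1)
    (hy₀ : ‖y₀‖ = 1) (hq : inner ℂ y₀ x₀ = q) {x : E} (hx : ‖x‖ = 1) :
    ∃ z : E, inner ℂ z x = 0 ∧ ‖z‖ ^ 2 = 1 - ‖q‖ ^ 2 := by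
  have hq1 : ‖q‖ ≤ 1 := by
    rw [← hq]; simpa [hx₀, hy₀] using norm_inner_le_norm (𝕜 := ℂ) y₀ x₀
  by_cases hbot : (Submodule.span ℂ {x})ᗮ = ⊥
  -- In dimension one, all unit vectors are parallel, so `‖q‖ = 1` and `z = 0` works.
  · have htop : Submodule.span ℂ {x} = ⊤ := (Submodule.orthogonal_eq_bot_iff).1 hbot
    obtain ⟨a, rfl⟩ := Submodule.mem_span_singleton.1 (htop ▸ Submodule.mem_top : x₀ ∈ _)
    obtain ⟨b, rfl⟩ := Submodule.mem_span_singleton.1 (htop ▸ Submodule.mem_top : y₀ ∈ _)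
    rw [norm_smul, hx, mul_one] at hx₀ hy₀
    refine ⟨0, inner_zero_left _, ?_⟩
    rw [← hq, inner_smul_left, inner_smul_right, inner_self_eq_norm_sq_to_K, hx]
    simp [hx₀, hy₀]
  · obtain ⟨w, hw, hw0⟩ := Submodule.exists_mem_ne_zero_of_ne_bot hbot
    have hn : ‖w‖ ≠ 0 := norm_ne_zero_iff.2 hw0
    have hnn : 0 ≤ 1 - ‖q‖ ^ 2 := by nlinarith [norm_nonneg q]
    refine ⟨((Real.sqrt (1 - ‖q‖ ^ 2) / ‖w‖ : ℝ) : ℂ) • w, ?_, ?_⟩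
    · rw [inner_smul_left, inner_eq_zero_symm.1
        (Submodule.mem_orthogonal_singleton_iff_inner_right.1 hw), mul_zero]
    · rw [norm_smul, Complex.norm_real, Real.norm_eq_abs, mul_pow, sq_abs, div_pow,
        Real.sq_sqrt hnn]
      field_simp

/-- With `z ⟂ x` and `‖z‖² = 1 - ‖q‖²`, both vectors `conj q • x ± z` are admissible partners of
`x`. Adding the two values removes the `z` term and leaves `2 q ⟨Tx, x⟩`. -/
lemma norm_mul_norm_inner_self_le_qNumericalRadius {q : ℂ}
    {x₀ y₀ : EuclideanSpace ℂ (Fin n)} (hx₀ : ‖x₀‖ = 1) (hy₀ : ‖y₀‖ = 1)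
    (hq : inner ℂ y₀ x₀ = q) (T : Matrix (Fin n) (Fin n) ℂ) {x : EuclideanSpace ℂ (Fin n)}
    (hx : ‖x‖ = 1) :
    ‖q‖ * ‖inner ℂ x (T.toEuclideanLin x)‖ ≤ qNumericalRadius q T := by
  obtain ⟨z, hzx, hz⟩ := exists_inner_eq_zero_norm_sq_eq hx₀ hy₀ hq hx
  have key : ∀ w : EuclideanSpace ℂ (Fin n), inner ℂ w x = 0 → ‖w‖ ^ 2 = 1 - ‖q‖ ^ 2 →
      ‖q * inner ℂ x (T.toEuclideanLin x) + inner ℂ w (T.toEuclideanLin x)‖ ≤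
        qNumericalRadius q T := by
    intro w hwx hw
    have h1 : ‖conj q • x + w‖ = 1 := by
      have h2 := norm_add_sq_eq_norm_sq_add_norm_sq_of_inner_eq_zero (𝕜 := ℂ) (conj q • x) w
        (by rw [inner_smul_left, inner_eq_zero_symm.1 hwx, mul_zero])
      rw [norm_smul, hx, mul_one, RCLike.norm_conj] at h2
      have h3 : ‖conj q • x + w‖ ^ 2 = 1 := by nlinarith
      exact (pow_eq_one_iff_of_nonneg (norm_nonneg _) two_ne_zero).1 h3
    have h4 : inner ℂ (conj q • x + w) x = q := by
      rw [inner_add_left, inner_smul_left, hwx, inner_self_eq_norm_sq_to_K, hx]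
      simp
    have h5 := norm_inner_le_qNumericalRadius q T hx h1 h4
    rwa [inner_add_left, inner_smul_left, Complex.conj_conj] at h5
  have h1 := key z hzx hz
  have h2 := key (-z) (by rw [inner_neg_left, hzx, neg_zero]) (by rwa [norm_neg])
  rw [inner_neg_left, ← sub_eq_add_neg] at h2
  set u := q * inner ℂ x (T.toEuclideanLin x) with hu
  set v := inner ℂ z (T.toEuclideanLin x)
  have h3 : ‖(u + v) + (u - v)‖ ≤ ‖u + v‖ + ‖u - v‖ := norm_add_le _ _
  have h4 : (u + v) + (u - v) = 2 * u := by ring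
  rw [h4, norm_mul, Complex.norm_ofNat] at h3
  rw [← norm_mul, ← hu]
  linarith

end Radius

/-! ### Real parts and inverses of sectorial matrices -/

section Sectorial

variable {α : ℝ} {A : Matrix (Fin n) (Fin n) ℂ}

lemma exists_norm_one_inner_eq (T : Matrix (Fin n) (Fin n) ℂ) {x : EuclideanSpace ℂ (Fin n)}
    (hx : x ≠ 0) : ∃ u : EuclideanSpace ℂ (Fin n), ‖u‖ = 1 ∧
      inner ℂ x (T.toEuclideanLin x) =
        ((‖x‖ ^ 2 : ℝ) : ℂ) * inner ℂ u (T.toEuclideanLin u) := by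
  have hn : (‖x‖ : ℂ) ≠ 0 := by simpa using hx
  refine ⟨((‖x‖⁻¹ : ℝ) : ℂ) • x, ?_, ?_⟩
  · rw [norm_smul, Complex.norm_real, norm_inv, norm_norm, inv_mul_cancel₀ (norm_ne_zero_iff.2 hx)]
  · rw [map_smul, inner_smul_left, inner_smul_right, Complex.conj_ofReal]
    push_cast
    field_simp

lemma IsSectorial.re_inner_pos (hA : IsSectorial α A) {x : EuclideanSpace ℂ (Fin n)}
    (hx : x ≠ 0) : 0 < (inner ℂ x (A.toEuclideanLin x)).re := by
  obtain ⟨u, hu, h⟩ := exists_norm_one_inner_eq A hx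
  rw [h, Complex.re_ofReal_mul]
  have := (hA ⟨u, hu, rfl⟩).1
  have := norm_pos_iff.2 hx
  positivity

lemma IsSectorial.abs_im_inner_le (hA : IsSectorial α A) (x : EuclideanSpace ℂ (Fin n)) :
    0 ≤ (inner ℂ x (A.toEuclideanLin x)).re ∧ |(inner ℂ x (A.toEuclideanLin x)).im| ≤
      Real.tan α * (inner ℂ x (A.toEuclideanLin x)).re := by
  rcases eq_or_ne x 0 with rfl | hx
  · simp
  refine ⟨(hA.re_inner_pos hx).le, ?_⟩
  obtain ⟨u, hu, h⟩ := exists_norm_one_inner_eq A hx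
  rw [h, Complex.re_ofReal_mul, Complex.im_ofReal_mul, abs_mul, abs_of_nonneg (sq_nonneg _)]
  have := (hA ⟨u, hu, rfl⟩).2
  calc _ ≤ ‖x‖ ^ 2 * (Real.tan α * (inner ℂ u (A.toEuclideanLin u)).re) := by gcongr
    _ = _ := by ring

lemma re_inner_le_qNumericalRadius_div {q : ℂ} (hq0 : q ≠ 0)
    {x₀ y₀ : EuclideanSpace ℂ (Fin n)} (hx₀ : ‖x₀‖ = 1) (hy₀ : ‖y₀‖ = 1)
    (hq : inner ℂ y₀ x₀ = q) (T : Matrix (Fin n) (Fin n) ℂ) (x : EuclideanSpace ℂ (Fin n)) :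
    (inner ℂ x (T.toEuclideanLin x)).re ≤ qNumericalRadius q T / ‖q‖ * ‖x‖ ^ 2 := by
  rcases eq_or_ne x 0 with rfl | hx
  · simp
  obtain ⟨u, hu, h⟩ := exists_norm_one_inner_eq T hx
  have h1 := norm_mul_norm_inner_self_le_qNumericalRadius hx₀ hy₀ hq T hu
  have h2 : (inner ℂ u (T.toEuclideanLin u)).re ≤ qNumericalRadius q T / ‖q‖ := by
    rw [le_div_iff₀ (norm_pos_iff.2 hq0), mul_comm]
    exact (mul_le_mul_of_nonneg_left (Complex.re_le_norm _) (norm_nonneg q)).trans h1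
  rw [h, Complex.re_ofReal_mul, mul_comm]
  gcongr

lemma isUnit_of_re_inner_pos {M : Matrix (Fin n) (Fin n) ℂ}
    (h : ∀ x : EuclideanSpace ℂ (Fin n), x ≠ 0 → 0 < (inner ℂ x (M.toEuclideanLin x)).re) :
    IsUnit M := by
  rw [← Matrix.mulVec_injective_iff_isUnit, ← Matrix.coe_mulVecLin, ← LinearMap.ker_eq_bot,
    LinearMap.ker_eq_bot']
  intro v hv
  by_contra hv0
  have h1 := h (WithLp.toLp 2 v) (by simpa using hv0)
  rw [Matrix.mulVecLin_apply] at hv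
  rw [Matrix.toLpLin_toLp, Matrix.toLin'_apply, hv] at h1
  simp at h1

lemma toEuclideanLin_inv_apply {M : Matrix (Fin n) (Fin n) ℂ} (hM : IsUnit M)
    (x : EuclideanSpace ℂ (Fin n)) : M.toEuclideanLin (M⁻¹.toEuclideanLin x) = x := by
  rw [Matrix.toLpLin_apply, Matrix.toLpLin_apply, Matrix.mulVec_mulVec,
    Matrix.mul_nonsing_inv _ ((Matrix.isUnit_iff_isUnit_det _).1 hM), Matrix.one_mulVec]

/-- The inverse of a matrix with real part at least `c` has norm at most `c⁻¹`. -/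
lemma norm_toEuclideanLin_inv_le {M : Matrix (Fin n) (Fin n) ℂ} {c : ℝ} (hc : 0 < c)
    (h : ∀ x, c * ‖x‖ ^ 2 ≤ (inner ℂ x (M.toEuclideanLin x)).re)
    (x : EuclideanSpace ℂ (Fin n)) : ‖M⁻¹.toEuclideanLin x‖ ≤ c⁻¹ * ‖x‖ := by
  have hM : IsUnit M := isUnit_of_re_inner_pos fun x hx => by
    have := norm_pos_iff.2 hx
    exact lt_of_lt_of_le (by positivity) (h x)
  set v := M⁻¹.toEuclideanLin x
  have hv : M.toEuclideanLin v = x := toEuclideanLin_inv_apply hM x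
  rcases eq_or_ne v 0 with h0 | h0
  · rw [h0, norm_zero]; positivity
  have h1 := h v
  rw [hv] at h1
  have h2 := (Complex.re_le_norm _).trans (norm_inner_le_norm (𝕜 := ℂ) v x)
  have h3 := norm_pos_iff.2 h0
  rw [← div_eq_inv_mul, le_div_iff₀ hc]
  refine le_of_mul_le_mul_left (a := ‖v‖) ?_ h3
  nlinarith

/-- The real part of the inverse of a sectorial matrix is bounded below. -/
lemma IsSectorial.le_re_inner_inv (hA : IsSectorial α A) (hα0 : 0 ≤ α) (hα1 : α < Real.pi / 2)
    {a : ℝ} (ha0 : 0 < a) (ha : ∀ x, (inner ℂ x (A.toEuclideanLin x)).re ≤ a * ‖x‖ ^ 2)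
    (x : EuclideanSpace ℂ (Fin n)) :
    Real.cos α ^ 2 * a⁻¹ * ‖x‖ ^ 2 ≤ (inner ℂ x (A⁻¹.toEuclideanLin x)).re := by
  have hcos : 0 < Real.cos α := Real.cos_pos_of_mem_Ioo ⟨by linarith [Real.pi_pos], hα1⟩
  have hM : IsUnit A := isUnit_of_re_inner_pos fun x hx => hA.re_inner_pos hx
  set v := A⁻¹.toEuclideanLin x
  have hv : A.toEuclideanLin v = x := toEuclideanLin_inv_apply hM x
  -- With `x = A v`, the bound on `‖A v‖²` by `Re ⟨A v, v⟩` is a lower bound for `Re ⟨A⁻¹ x, x⟩`,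
  -- and `1 + tan² α = sec² α`.
  have h := norm_sq_le_of_slope A.toEuclideanLin
    (Real.tan_nonneg_of_nonneg_of_le_pi_div_two hα0 hα1.le) hA.abs_im_inner_le ha v
  have ht : 1 + Real.tan α ^ 2 = (Real.cos α ^ 2)⁻¹ := by
    rw [← Real.inv_one_add_tan_sq hcos.ne', inv_inv]
  have hs : (inner ℂ x v).re = (inner ℂ v x).re := inner_re_symm (𝕜 := ℂ) x v
  rw [hv, ht] at h
  rw [hs]
  calc _ ≤ Real.cos α ^ 2 * a⁻¹ * ((Real.cos α ^ 2)⁻¹ * a * (inner ℂ v x).re) := by gcongr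
    _ = _ := by field_simp

/-- The common bound behind both means. -/
lemma norm_toEuclideanLin_inv_combination_le {B : Matrix (Fin n) (Fin n) ℂ}
    (hA : IsSectorial α A) (hB : IsSectorial α B) (hα0 : 0 ≤ α) (hα1 : α < Real.pi / 2)
    {a b : ℝ} (ha0 : 0 < a) (hb0 : 0 < b)
    (ha : ∀ x, (inner ℂ x (A.toEuclideanLin x)).re ≤ a * ‖x‖ ^ 2)
    (hb : ∀ x, (inner ℂ x (B.toEuclideanLin x)).re ≤ b * ‖x‖ ^ 2)
    {r s : ℝ} (hr : 0 < r) (hs : 0 < s) (x : EuclideanSpace ℂ (Fin n)) :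
    ‖((r : ℂ) • A⁻¹ + (s : ℂ) • B⁻¹)⁻¹.toEuclideanLin x‖ ≤
      (1 / Real.cos α) ^ 2 * (r * a⁻¹ + s * b⁻¹)⁻¹ * ‖x‖ := by
  have hcos : 0 < Real.cos α := Real.cos_pos_of_mem_Ioo ⟨by linarith [Real.pi_pos], hα1⟩
  have hc : 0 < Real.cos α ^ 2 * (r * a⁻¹ + s * b⁻¹) := by positivity
  refine (norm_toEuclideanLin_inv_le hc (fun x => ?_) x).trans_eq ?_
  · have h1 := hA.le_re_inner_inv hα0 hα1 ha0 ha x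
    have h2 := hB.le_re_inner_inv hα0 hα1 hb0 hb x
    rw [map_add, map_smul, map_smul, LinearMap.add_apply, LinearMap.smul_apply,
      LinearMap.smul_apply, inner_add_right, inner_smul_right, inner_smul_right, Complex.add_re,
      Complex.re_ofReal_mul, Complex.re_ofReal_mul]
    nlinarith
  · rw [mul_inv, one_div, inv_pow]

end Sectorial

/-! ### Norm bound for the geometric mean -/

section GeometricMean

open MeasureTheory Set

variable {α t a b : ℝ} {A B : Matrix (Fin n) (Fin n) ℂ}

/-- Cramer's formula: determinant and adjugate are continuous in `s`, and scalar inversion is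
measurable even at `0`, so invertibility is not needed. -/
lemma measurable_inv_add_smul_inv_apply (A B : Matrix (Fin n) (Fin n) ℂ) (i j : Fin n) :
    Measurable fun s : ℝ => (A + (s : ℂ) • B)⁻¹ i j := by
  have hc : Continuous fun s : ℝ => A + (s : ℂ) • B := by fun_prop
  have h1 : Measurable fun s : ℝ => ((A + (s : ℂ) • B).det)⁻¹ := hc.matrix_det.measurable.inv
  have h2 : Measurable fun s : ℝ => (A + (s : ℂ) • B).adjugate i j :=
    (hc.matrix_adjugate.matrix_elem i j).measurable
  simpa [Matrix.inv_def, Pi.mul_def] using h1.mul h2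

lemma norm_apply_le_of_norm_toEuclideanLin_le {M : Matrix (Fin n) (Fin n) ℂ} {C : ℝ}
    (h : ∀ x, ‖M.toEuclideanLin x‖ ≤ C * ‖x‖) (i j : Fin n) : ‖M i j‖ ≤ C := by
  have h1 := (PiLp.norm_apply_le (M.toEuclideanLin (EuclideanSpace.single j 1)) i).trans (h _)
  simpa [Matrix.toLpLin_apply] using h1

lemma inner_toEuclideanLin_eq_sum (M : Matrix (Fin n) (Fin n) ℂ)
    (x y : EuclideanSpace ℂ (Fin n)) :
    inner ℂ y (M.toEuclideanLin x) = ∑ i, ∑ j, (x j * conj (y i)) * M i j := by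
  simp only [PiLp.inner_apply, Matrix.toLpLin_apply, Matrix.mulVec, dotProduct,
    RCLike.inner_apply, Finset.sum_mul]
  refine Finset.sum_congr rfl fun i _ => Finset.sum_congr rfl fun j _ => by ring

lemma norm_toEuclideanLin_weightedGeometricMean_le (ht0 : 0 < t) (ht1 : t < 1)
    (hA : IsSectorial α A) (hB : IsSectorial α B) (hα0 : 0 ≤ α) (hα1 : α < Real.pi / 2)
    (ha0 : 0 < a) (hb0 : 0 < b)
    (ha : ∀ x, (inner ℂ x (A.toEuclideanLin x)).re ≤ a * ‖x‖ ^ 2)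
    (hb : ∀ x, (inner ℂ x (B.toEuclideanLin x)).re ≤ b * ‖x‖ ^ 2)
    (x : EuclideanSpace ℂ (Fin n)) :
    ‖(weightedGeometricMean t A B).toEuclideanLin x‖ ≤
      (1 / Real.cos α) ^ 2 * (a ^ (1 - t) * b ^ t) * ‖x‖ := by
  have hsin : 0 < Real.sin (Real.pi * t) := Real.sin_pos_of_pos_of_lt_pi (by positivity)
    (by nlinarith [Real.pi_pos])
  set C := (1 / Real.cos α) ^ 2 with hC
  set M : ℝ → Matrix (Fin n) (Fin n) ℂ := fun s => (A⁻¹ + (s : ℂ) • B⁻¹)⁻¹ with hM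
  have hbound : ∀ s ∈ Ioi (0 : ℝ), ∀ x, ‖(M s).toEuclideanLin x‖ ≤
      C * (a⁻¹ + s * b⁻¹)⁻¹ * ‖x‖ := fun s hs x => by
    simpa [hM, hC] using
      norm_toEuclideanLin_inv_combination_le hA hB hα0 hα1 ha0 hb0 ha hb one_pos hs x
  have hint := integrableOn_Ioi_rpow_div_add ht0 ht1 (inv_pos.2 ha0) (inv_pos.2 hb0)
  have hentry : ∀ i j, IntegrableOn (fun s : ℝ => ((s ^ (t - 1) : ℝ) : ℂ) * M s i j)
      (Ioi 0) := by
    intro i j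
    refine Integrable.mono' (hint.const_mul C) ?_ ?_
    · have h1 := measurable_inv_add_smul_inv_apply A⁻¹ B⁻¹ i j
      have h2 : Measurable fun s : ℝ => ((s ^ (t - 1) : ℝ) : ℂ) := by fun_prop
      exact (h2.mul h1).aestronglyMeasurable
    · filter_upwards [ae_restrict_mem measurableSet_Ioi] with s hs
      have h1 := norm_apply_le_of_norm_toEuclideanLin_le (hbound s hs) i j
      have h2 := Real.rpow_nonneg (le_of_lt hs) (t - 1)
      rw [norm_mul, Complex.norm_real, Real.norm_of_nonneg h2]
      calc _ ≤ s ^ (t - 1) * (C * (a⁻¹ + s * b⁻¹)⁻¹) := by gcongr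
        _ = _ := by ring
  -- The mean is defined entrywise; pairing with `y` makes it one scalar integral, to which the
  -- operator bound on `M s` applies.
  have hinner : ∀ y, inner ℂ y ((weightedGeometricMean t A B).toEuclideanLin x) =
      ((Real.sin (Real.pi * t) / Real.pi : ℝ) : ℂ) *
        ∫ s in Ioi (0 : ℝ), ((s ^ (t - 1) : ℝ) : ℂ) * inner ℂ y ((M s).toEuclideanLin x) := by
    intro y
    simp only [inner_toEuclideanLin_eq_sum, Finset.mul_sum]
    rw [integral_finsetSum _ fun i _ => integrable_finsetSum _ fun j _ => by
      simpa only [mul_left_comm] using (hentry i j).const_mul (x j * conj (y i)), Finset.mul_sum]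
    refine Finset.sum_congr rfl fun i _ => ?_
    rw [integral_finsetSum _ fun j _ => by
      simpa only [mul_left_comm] using (hentry i j).const_mul (x j * conj (y i)), Finset.mul_sum]
    refine Finset.sum_congr rfl fun j _ => ?_
    simp only [weightedGeometricMean, Matrix.of_apply]
    rw [mul_left_comm, ← integral_const_mul]
    simp only [hM, mul_left_comm]
  have hle : ∀ y, ‖inner ℂ y ((weightedGeometricMean t A B).toEuclideanLin x)‖ ≤
      C * (a ^ (1 - t) * b ^ t) * ‖x‖ * ‖y‖ := by
    intro y
    have h1 : ‖∫ s in Ioi (0 : ℝ), ((s ^ (t - 1) : ℝ) : ℂ) *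
        inner ℂ y ((M s).toEuclideanLin x)‖ ≤
        ∫ s in Ioi (0 : ℝ), (C * ‖x‖ * ‖y‖) * (s ^ (t - 1) * (a⁻¹ + s * b⁻¹)⁻¹) := by
      refine norm_integral_le_of_norm_le (hint.const_mul _) ?_
      filter_upwards [ae_restrict_mem measurableSet_Ioi] with s hs
      have h2 := Real.rpow_nonneg (le_of_lt hs) (t - 1)
      rw [norm_mul, Complex.norm_real, Real.norm_of_nonneg h2]
      calc _ ≤ s ^ (t - 1) * (‖y‖ * (C * (a⁻¹ + s * b⁻¹)⁻¹ * ‖x‖)) := by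
            gcongr
            exact (norm_inner_le_norm _ _).trans (by gcongr; exact hbound s hs x)
        _ = _ := by ring
    rw [integral_const_mul, integral_Ioi_rpow_div_add ht0 ht1 (inv_pos.2 ha0) (inv_pos.2 hb0),
      inv_inv, inv_inv] at h1
    rw [hinner, norm_mul, Complex.norm_real, Real.norm_of_nonneg (by positivity)]
    calc _ ≤ Real.sin (Real.pi * t) / Real.pi * (C * ‖x‖ * ‖y‖ *
          (Real.pi / Real.sin (Real.pi * t) * (a ^ (1 - t) * b ^ t))) := by gcongr
      _ = _ := by field_simp
  set v := (weightedGeometricMean t A B).toEuclideanLin x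
  rcases eq_or_ne v 0 with h0 | h0
  · rw [h0, norm_zero]; positivity
  -- Duality: `y = v` gives `‖v‖² ≤ (bound) · ‖v‖`.
  have h1 := hle v
  rw [inner_self_eq_norm_sq_to_K] at h1
  simp only [Complex.coe_algebraMap, norm_pow, Complex.norm_real, norm_norm] at h1
  rw [sq] at h1
  exact le_of_mul_le_mul_right h1 (norm_pos_iff.2 h0)

end GeometricMean

end SectorialMeans

/-! ### The two inequalities -/

theorem mainTheorem7 {n : ℕ} (α : ℝ) (hα0 : 0 ≤ α) (hα1 : α < Real.pi / 2)
    (A B : Matrix (Fin n) (Fin n) ℂ)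
    (hA : SectorialMeans.IsSectorial α A) (hB : SectorialMeans.IsSectorial α B)
    (q : ℂ) (hq0 : q ≠ 0) (hq1 : ‖q‖ ≤ 1) (t : ℝ) (ht0 : 0 < t) (ht1 : t < 1) :
    ‖q‖ ^ 2 * SectorialMeans.qNumericalRadius q (SectorialMeans.weightedGeometricMean t A B) ≤
        (1 / Real.cos α) ^ 3 *
          (SectorialMeans.qNumericalRadius q A ^ (1 - t) *
            SectorialMeans.qNumericalRadius q B ^ t) ∧
      ‖q‖ ^ 2 * SectorialMeans.qNumericalRadius q (SectorialMeans.weightedHarmonicMean t A B) ≤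
        (1 / Real.cos α) ^ 3 *
          ((1 - t) * (SectorialMeans.qNumericalRadius q A)⁻¹ +
            t * (SectorialMeans.qNumericalRadius q B)⁻¹)⁻¹ := by
  open SectorialMeans in
  have hcos : 0 < Real.cos α := Real.cos_pos_of_mem_Ioo ⟨by linarith [Real.pi_pos], hα1⟩
  have hsec : 1 ≤ 1 / Real.cos α := by
    rw [le_div_iff₀ hcos, one_mul]; exact Real.cos_le_one α
  have ht1' : 0 < 1 - t := by linarith
  have hwA := qNumericalRadius_nonneg q A
  have hwB := qNumericalRadius_nonneg q B
  by_cases hne : ∃ x y : EuclideanSpace ℂ (Fin n), ‖x‖ = 1 ∧ ‖y‖ = 1 ∧ inner ℂ y x = q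
  swap
  -- No admissible pair exists: the left sides vanish because `sSup ∅ = 0`.
  · have h0 := qNumericalRadius_eq_zero_of_forall (n := n) (q := q)
      fun x y hx hy h => hne ⟨x, y, hx, hy, h⟩
    rw [h0 (weightedGeometricMean t A B), h0 (weightedHarmonicMean t A B), mul_zero]
    constructor <;> positivity
  obtain ⟨x₀, y₀, hx₀, hy₀, hq⟩ := hne
  have hqpos : 0 < ‖q‖ := norm_pos_iff.2 hq0
  have hx₀ne : x₀ ≠ 0 := fun h => by simp [h] at hx₀
  have ha := re_inner_le_qNumericalRadius_div hq0 hx₀ hy₀ hq A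
  have hb := re_inner_le_qNumericalRadius_div hq0 hx₀ hy₀ hq B
  have ha0 : 0 < qNumericalRadius q A / ‖q‖ := by
    simpa [hx₀] using (hA.re_inner_pos hx₀ne).trans_le (ha x₀)
  have hb0 : 0 < qNumericalRadius q B / ‖q‖ := by
    simpa [hx₀] using (hB.re_inner_pos hx₀ne).trans_le (hb x₀)
  have hA0 : 0 < qNumericalRadius q A := by
    simpa [hqpos.ne'] using mul_pos ha0 hqpos
  have hB0 : 0 < qNumericalRadius q B := by
    simpa [hqpos.ne'] using mul_pos hb0 hqpos
  -- The argument yields `‖q‖ w ≤ sec² α · m`; the stated form follows from `‖q‖ ≤ 1 ≤ sec α`.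
  have final : ∀ w m : ℝ, 0 ≤ m → w ≤ (1 / Real.cos α) ^ 2 * (m / ‖q‖) →
      ‖q‖ ^ 2 * w ≤ (1 / Real.cos α) ^ 3 * m := by
    intro w m hm hw
    calc ‖q‖ ^ 2 * w ≤ ‖q‖ ^ 2 * ((1 / Real.cos α) ^ 2 * (m / ‖q‖)) := by gcongr
      _ = ‖q‖ * ((1 / Real.cos α) ^ 2 * m) := by field_simp
      _ ≤ (1 / Real.cos α) * ((1 / Real.cos α) ^ 2 * m) := by
        gcongr
        exact hq1.trans hsec
      _ = _ := by ring
  refine ⟨final _ _ (by positivity) ?_, final _ _ (by positivity) ?_⟩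
  · have hm : (qNumericalRadius q A / ‖q‖) ^ (1 - t) * (qNumericalRadius q B / ‖q‖) ^ t =
        (qNumericalRadius q A ^ (1 - t) * qNumericalRadius q B ^ t) / ‖q‖ := by
      rw [Real.div_rpow hwA hqpos.le, Real.div_rpow hwB hqpos.le, div_mul_div_comm,
        ← Real.rpow_add hqpos, sub_add_cancel, Real.rpow_one]
    rw [← hm]
    exact qNumericalRadius_le (by positivity)
      (norm_toEuclideanLin_weightedGeometricMean_le ht0 ht1 hA hB hα0 hα1 ha0 hb0 ha hb)
  · have hm : ((1 - t) * (qNumericalRadius q A / ‖q‖)⁻¹ +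
        t * (qNumericalRadius q B / ‖q‖)⁻¹)⁻¹ =
        ((1 - t) * (qNumericalRadius q A)⁻¹ + t * (qNumericalRadius q B)⁻¹)⁻¹ / ‖q‖ := by
      rw [inv_div, inv_div, eq_div_iff hqpos.ne', ← inv_inj, mul_inv, inv_inv, inv_inv]
      field_simp
    rw [← hm]
    exact qNumericalRadius_le (by positivity)
      (norm_toEuclideanLin_inv_combination_le hA hB hα0 hα1 ha0 hb0 ha hb ht1' ht0)
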